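/- Let $p$ be a probability distribution on an input space $U$, let $X_1,\dots,X_K:U\to\mathbb R$ be readout functions and $y:U\to\mathbb R$ a target function, all with finite sixth moments under $p$, and write $E[f]=\int f\,dp$. Assume $E[y^2]>0$ and that the Gram matrix $G_{ij}=E[X_iX_j]$ has full rank. Let $\Lambda$ be any $K\times K$ matrix with $\Lambda^\top G\Lambda=\mathbb I$, and put $\tilde X_l=\sum_i X_i\Lambda_{il}$, so that $E[\tilde X_i\tilde X_j]=\delta_{ij}$. Assume that the capacity $$C(y,X)=1-\frac{\inf_{W\in\mathbb R^K}E\big[(\sum_iW_iX_i-y)^2\big]}{E[y^2]}$$ is $0$. Let $u(1),u(2),\dots$ be independent random inputs with distribution $p$, and let the empirical capacity on $N$ samples, with $E[y^2]$ known exactly, be $$C_N(y,X)=\frac{R_N^\top G_N^{-1}R_N}{E[y^2]},\qquad (R_N)_i=\frac1N\sum_{n=1}^N X_i(u(n))\,y(u(n)),\qquad (G_N)_{ij}=\frac1N\sum_{n=1}^N X_i(u(n))X_j(u(n)),$$ where $G_N^{-1}$ is the Moore–Penrose pseudo-inverse if $G_N$ is singular. Then for every $N$ the random variable $C_N(y,X)$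 is integrable, and as $N\to\infty$ (with $K$, $p$, $X$, $y$ fixed) its expectation over datasets satisfies $$E\big[C_N(y,X)\big]=\frac{\Delta(y,X)}{N}+\mathcal O\big(N^{-3/2}\big),$$ where $$\Delta(y,X)=\frac{E\big[\big(\sum_{i=1}^K\tilde X_i^2\big)y^2\big]}{E[y^2]}\le\frac{\sqrt{E\big[\big(\sum_{i=1}^K\tilde X_i^2\big)^2\big]\,E[y^4]}}{E[y^2]}.$$ -/

import Mathlib

open MeasureTheory ProbabilityTheory Filter Asymptotics Matrix

namespace StationarySystem

/-! ### Moore-Penrose pseudo-inverse of a square real matrix -/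

/-- `B` is the Moore-Penrose pseudo-inverse of the real square matrix `A`: the four Penrose
equations hold. -/
structure IsPseudoInverse {K : ℕ} (A B : Matrix (Fin K) (Fin K) ℝ) : Prop where
  mul_mul_self : A * B * A = A
  self_mul_mul : B * A * B = B
  left_symm : (A * B)ᵀ = A * B
  right_symm : (B * A)ᵀ = B * A

/-- The four Penrose equations have at most one solution. -/
theorem IsPseudoInverse.unique {K : ℕ} {A B C : Matrix (Fin K) (Fin K) ℝ}
    (hB : IsPseudoInverse A B) (hC : IsPseudoInverse A C) : B = C := by
  have h1 : A * B = A * C := by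
    calc A * B = (A * C * A) * B := by rw [hC.mul_mul_self]
      _ = (A * C)ᵀ * (A * B)ᵀ := by
        rw [hC.left_symm, hB.left_symm]; simp only [Matrix.mul_assoc]
      _ = (A * B * A * C)ᵀ := by
        rw [← Matrix.transpose_mul]; simp only [Matrix.mul_assoc]
      _ = A * C := by rw [hB.mul_mul_self, hC.left_symm]
  have h2 : B * A = C * A := by
    calc B * A = B * (A * C * A) := by rw [hC.mul_mul_self]
      _ = (B * A)ᵀ * (C * A)ᵀ := by
        rw [hC.right_symm, hB.right_symm]; simp only [Matrix.mul_assoc]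
      _ = (C * (A * B * A))ᵀ := by
        rw [← Matrix.transpose_mul]; simp only [Matrix.mul_assoc]
      _ = C * A := by rw [hB.mul_mul_self, hC.right_symm]
  calc B = B * A * B := hB.self_mul_mul.symm
    _ = C * A * C := by rw [h2, Matrix.mul_assoc, h1, Matrix.mul_assoc]
    _ = C := hC.self_mul_mul

/-- Every real symmetric matrix has a Moore-Penrose pseudo-inverse. -/
theorem exists_isPseudoInverse {K : ℕ} {A : Matrix (Fin K) (Fin K) ℝ} (hA : Aᵀ = A) :
    ∃ B, IsPseudoInverse A B := by
  have hH : A.IsHermitian := by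
    rw [Matrix.IsHermitian, Matrix.conjTranspose_eq_transpose_of_trivial, hA]
  obtain ⟨U, d, hU, hAd⟩ : ∃ (U : Matrix (Fin K) (Fin K) ℝ) (d : Fin K → ℝ),
      Uᵀ * U = 1 ∧ A = U * Matrix.diagonal d * Uᵀ := by
    refine ⟨hH.eigenvectorUnitary, hH.eigenvalues, ?_, ?_⟩
    · have := Unitary.coe_star_mul_self hH.eigenvectorUnitary
      rwa [Matrix.star_eq_conjTranspose, Matrix.conjTranspose_eq_transpose_of_trivial] at this
    · have := hH.spectral_theorem
      rw [Unitary.conjStarAlgAut_apply, Matrix.star_eq_conjTranspose,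
        Matrix.conjTranspose_eq_transpose_of_trivial] at this
      simpa using this
  have key : ∀ a b : Fin K → ℝ, (U * Matrix.diagonal a * Uᵀ) * (U * Matrix.diagonal b * Uᵀ)
      = U * Matrix.diagonal (fun i => a i * b i) * Uᵀ := by
    intro a b
    calc _ = U * Matrix.diagonal a * (Uᵀ * U) * Matrix.diagonal b * Uᵀ := by
          simp only [Matrix.mul_assoc]
      _ = _ := by
          rw [hU, Matrix.mul_one, Matrix.mul_assoc U, Matrix.diagonal_mul_diagonal]
  have hT : ∀ a : Fin K → ℝ, (U * Matrix.diagonal a * Uᵀ)ᵀ = U * Matrix.diagonal a * Uᵀ := by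
    intro a
    simp [Matrix.transpose_mul, Matrix.mul_assoc]
  refine ⟨U * Matrix.diagonal (fun i => (d i)⁻¹) * Uᵀ, ?_⟩
  subst hAd
  refine ⟨?_, ?_, ?_, ?_⟩
  · rw [key, key]; congr; funext i; exact mul_inv_mul_cancel (d i)
  · rw [key, key]; congr; funext i
    simpa using mul_inv_mul_cancel (d i)⁻¹
  · rw [key, hT]
  · rw [key, hT]

open Classical in
/-- The Moore-Penrose pseudo-inverse of a real square matrix. -/
noncomputable def pinv {K : ℕ} (A : Matrix (Fin K) (Fin K) ℝ) : Matrix (Fin K) (Fin K) ℝ :=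
  if h : ∃ B, IsPseudoInverse A B then h.choose else 0

/-- On symmetric matrices `pinv` satisfies the Penrose equations. -/
theorem isPseudoInverse_pinv {K : ℕ} {A : Matrix (Fin K) (Fin K) ℝ} (hA : Aᵀ = A) :
    IsPseudoInverse A (pinv A) := by
  have h := exists_isPseudoInverse hA
  rw [pinv, dif_pos h]
  exact h.choose_spec

/-- On invertible symmetric matrices `pinv` is the inverse. -/
theorem pinv_eq_inv {K : ℕ} {A : Matrix (Fin K) (Fin K) ℝ} (hA : Aᵀ = A)
    (hdet : IsUnit A.det) : pinv A = A⁻¹ := by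
  refine (isPseudoInverse_pinv hA).unique ⟨?_, ?_, ?_, ?_⟩ <;>
    simp [Matrix.mul_nonsing_inv _ hdet, Matrix.nonsing_inv_mul _ hdet]

/-! ### Population quantities

The inputs live in `U` and are distributed according to `p`; the readouts are the functions
`X 1, …, X K` and the target is `y`. -/

section Population

variable {U : Type*} [MeasurableSpace U]

/-- Gram matrix `G i j = E[X i * X j]`. -/
noncomputable def gram {K : ℕ} (p : Measure U) (X : Fin K → U → ℝ) :
    Matrix (Fin K) (Fin K) ℝ :=
  Matrix.of fun i j => ∫ v, X i v * X j v ∂p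

/-- Mean squared error of the linear output `∑ i, W i * X i`. -/
noncomputable def mse {K : ℕ} (p : Measure U) (X : Fin K → U → ℝ) (y : U → ℝ)
    (W : Fin K → ℝ) : ℝ :=
  ∫ v, ((∑ i, W i * X i v) - y v) ^ 2 ∂p

/-- Optimized mean squared error over all weights. -/
noncomputable def minMse {K : ℕ} (p : Measure U) (X : Fin K → U → ℝ) (y : U → ℝ) : ℝ :=
  ⨅ W : Fin K → ℝ, mse p X y W

/-- Capacity `C(y, X) = 1 - MSE* / E[y ^ 2]`. -/
noncomputable def capacity {K : ℕ} (p : Measure U) (X : Fin K → U → ℝ) (y : U → ℝ) : ℝ :=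
  1 - minMse p X y / ∫ v, y v ^ 2 ∂p

/-- Transformed readouts `X̃ l = ∑ i, X i * Λ i l`. -/
def transformed {K : ℕ} (X : Fin K → U → ℝ) (Λ : Matrix (Fin K) (Fin K) ℝ) (l : Fin K) (v : U) :
    ℝ :=
  ∑ i, X i v * Λ i l

/-- `Δ = E[(∑ i, X̃ i ^ 2) * y ^ 2] / E[y ^ 2]`, as a function of the readouts `Xt` (meant to be
orthonormal) and the target. -/
noncomputable def Delta {K : ℕ} (p : Measure U) (Xt : Fin K → U → ℝ) (y : U → ℝ) : ℝ :=
  (∫ v, (∑ i, Xt i v ^ 2) * y v ^ 2 ∂p) / ∫ v, y v ^ 2 ∂p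

end Population

/-! ### Empirical quantities, for a sequence of inputs `s 0, s 1, …` cut after `N` terms -/

section Empirical

variable {U : Type*}

/-- Empirical Gram matrix over the first `N` samples. -/
noncomputable def empGram {K : ℕ} (X : Fin K → U → ℝ) (s : ℕ → U) (N : ℕ) :
    Matrix (Fin K) (Fin K) ℝ :=
  Matrix.of fun i j => (1 / (N : ℝ)) * ∑ n ∈ Finset.range N, X i (s n) * X j (s n)

/-- Empirical correlation vector over the first `N` samples. -/
noncomputable def empCorr {K : ℕ} (X : Fin K → U → ℝ) (y : U → ℝ) (s : ℕ → U) (N : ℕ) :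
    Fin K → ℝ :=
  fun i => (1 / (N : ℝ)) * ∑ n ∈ Finset.range N, X i (s n) * y (s n)

/-- Empirical capacity `C_N(y, X) = R_Nᵀ G_N⁻¹ R_N / E[y ^ 2]` when `m = E[y ^ 2]` is known
exactly; the inverse is the pseudo-inverse where the empirical Gram matrix is singular. -/
noncomputable def empCapacity {K : ℕ} (m : ℝ) (X : Fin K → U → ℝ) (y : U → ℝ) (s : ℕ → U)
    (N : ℕ) : ℝ :=
  (empCorr X y s N ⬝ᵥ (pinv (empGram X s N) *ᵥ empCorr X y s N)) / m

end Empirical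

end StationarySystem

namespace StationarySystem

/-! ### Moments of sums of independent centred random variables -/

/-! Zero capacity forces `E[X i * y] = 0`, so the correlation vector `R` is an average of centred
i.i.d. vectors, of size `N ^ (-1/2)`. If the empirical Gram matrix is replaced by `G`, then `G⁻¹ = Λ
* Λᵀ` turns the quadratic form into a sum of squares of empirical means of `X̃ l * y`, whose
expectation is exactly `Δ * E[y ^ 2] / N` (`integral_inv_quadratic`).

The replacement costs `O(t ^ 3)` for every dataset, where `t` is the sum of the absolute deviations
of the empirical means of `X i * X j`, `X i * y` and `y ^ 2` (`exists_pinv_quadratic_sub_le`). For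
small `t`, inversion is Lipschitz and the error is `t * t ^ 2`. For `t` bounded below, the empirical
form is a squared projection, hence between `0` and the empirical mean of `y ^ 2`
(`pinv_empGram_quadratic_le`), and every term is dominated by `t ^ 3`. No tail estimate for singular
Gram matrices is needed. Finally `E[t ^ 3] = O(N ^ (-3/2))` by a third-moment bound for sums
(`integral_abs_sum_range_pow_three_le`), which uses third moments of products, hence sixth moments
of the factors. -/

/-- Taylor expansion of `|x| ^ 3` at `a`. The linear term is kept exact, since it averages to zero
for `b` centred and independent of `a`. -/
theorem abs_add_pow_three_le (a b : ℝ) :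
    |a + b| ^ 3 ≤ |a| ^ 3 + 3 * (a * |a| * b) + 3 * (|a| * b ^ 2) + |b| ^ 3 := by
  rcases abs_cases a with ⟨ha, h1⟩ | ⟨ha, h1⟩ <;> rcases abs_cases b with ⟨hb, h2⟩ | ⟨hb, h2⟩ <;>
    rcases abs_cases (a + b) with ⟨hc, h3⟩ | ⟨hc, h3⟩ <;> rw [ha, hb, hc]
  · nlinarith
  · nlinarith
  · have : b ^ 3 ≤ 0 := by nlinarith [sq_nonneg b]
    nlinarith
  -- When `a` and `a + b` have opposite signs, the defect is `2|a|(a² + 3ab + 3b²)`, and `4(a² + 3ab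
  -- + 3b²) = (2a + 3b)² + 3b²`.
  · nlinarith [mul_nonneg h1 (add_nonneg (sq_nonneg (2 * a + 3 * b)) (sq_nonneg b))]
  · nlinarith [mul_nonneg (neg_pos.2 h1).le
      (add_nonneg (sq_nonneg (2 * a + 3 * b)) (sq_nonneg b))]
  · have : 0 ≤ b ^ 3 := by positivity
    nlinarith
  · nlinarith
  · nlinarith

section Sums

variable {Ω : Type*} [MeasurableSpace Ω] {μ : Measure Ω}

theorem integral_abs_le_sqrt [IsProbabilityMeasure μ] {f : Ω → ℝ} (hf : MemLp f 2 μ) :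
    ∫ ω, |f ω| ∂μ ≤ Real.sqrt (∫ ω, f ω ^ 2 ∂μ) := by
  apply Real.le_sqrt_of_sq_le
  have h := variance_nonneg (fun ω => |f ω|) μ
  rw [variance_eq_sub (X := fun ω => |f ω|) hf.abs] at h
  simpa using h

theorem memLp_sum_range {ξ : ℕ → Ω → ℝ} {q : ENNReal} (hL : ∀ n, MemLp (ξ n) q μ) (n : ℕ) :
    MemLp (fun ω => ∑ k ∈ Finset.range n, ξ k ω) q μ :=
  memLp_finsetSum _ fun k _ => hL k

theorem indepFun_sum_range {ξ : ℕ → Ω → ℝ} (hi : iIndepFun ξ μ)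
    (hm : ∀ n, AEMeasurable (ξ n) μ) (n : ℕ) :
    IndepFun (fun ω => ∑ k ∈ Finset.range n, ξ k ω) (ξ n) μ := by
  have h := hi.indepFun_sum_range_succ₀ hm n
  convert h using 1
  ext ω
  simp

theorem integral_sum_range_sq {ξ : ℕ → Ω → ℝ} (hi : iIndepFun ξ μ)
    (hL : ∀ n, MemLp (ξ n) 2 μ) (h0 : ∀ n, ∫ ω, ξ n ω ∂μ = 0) {v : ℝ}
    (hv : ∀ n, ∫ ω, ξ n ω ^ 2 ∂μ = v) (n : ℕ) :
    ∫ ω, (∑ k ∈ Finset.range n, ξ k ω) ^ 2 ∂μ = n * v := by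
  induction n with
  | zero => simp
  | succ n ih =>
    have hS := memLp_sum_range hL n
    have hind := indepFun_sum_range hi (fun n => (hL n).aemeasurable) n
    have hp := hind.integral_fun_mul_eq_mul_integral hS.aestronglyMeasurable
      (hL n).aestronglyMeasurable
    rw [h0, mul_zero] at hp
    have i1 := hS.integrable_sq
    have i2 : Integrable (fun ω => 2 * ((∑ k ∈ Finset.range n, ξ k ω) * ξ n ω)) μ :=
      (hS.integrable_mul (hL n)).const_mul 2
    have i3 := (hL n).integrable_sq
    calc ∫ ω, (∑ k ∈ Finset.range (n + 1), ξ k ω) ^ 2 ∂μ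
        = ∫ ω, ((∑ k ∈ Finset.range n, ξ k ω) ^ 2
            + 2 * ((∑ k ∈ Finset.range n, ξ k ω) * ξ n ω) + ξ n ω ^ 2) ∂μ := by
          congr 1 with ω
          rw [Finset.sum_range_succ]
          ring
      _ = n * v + v := by
          rw [integral_add (i1.fun_add i2) i3, integral_add i1 i2, integral_const_mul, hp, ih, hv]
          ring
      _ = _ := by push_cast; ring

/-- A Marcinkiewicz-Zygmund bound for third absolute moments. -/
theorem integral_abs_sum_range_pow_three_le [IsProbabilityMeasure μ] {ξ : ℕ → Ω → ℝ}
    (hi : iIndepFun ξ μ)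
    (hL : ∀ n, MemLp (ξ n) 3 μ) (h0 : ∀ n, ∫ ω, ξ n ω ∂μ = 0) {v ρ : ℝ}
    (hv : ∀ n, ∫ ω, ξ n ω ^ 2 ∂μ = v) (hρ : ∀ n, ∫ ω, |ξ n ω| ^ 3 ∂μ = ρ) (n : ℕ) :
    ∫ ω, |∑ k ∈ Finset.range n, ξ k ω| ^ 3 ∂μ
      ≤ (3 * (Real.sqrt v * v) + ρ) * (n * Real.sqrt n) := by
  have hv0 : 0 ≤ v := hv 0 ▸ integral_nonneg fun ω => sq_nonneg _
  have hρ0 : 0 ≤ ρ := hρ 0 ▸ integral_nonneg fun ω => by positivity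
  have hL2 : ∀ n, MemLp (ξ n) 2 μ := fun n => (hL n).mono_exponent (by norm_num)
  have cube : ∀ {f : Ω → ℝ}, MemLp f 3 μ → Integrable (fun ω => |f ω| ^ 3) μ := fun {f} hf => by
    simpa using MemLp.integrable_norm_pow (p := 3) hf (by norm_num)
  induction n with
  | zero => simp
  | succ n ih =>
    set S : Ω → ℝ := fun ω => ∑ k ∈ Finset.range n, ξ k ω
    have hS : MemLp S 3 μ := memLp_sum_range hL n
    have hS2 : MemLp S 2 μ := memLp_sum_range hL2 n
    have hind : IndepFun S (ξ n) μ := indepFun_sum_range hi (fun n => (hL n).aemeasurable) n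
    have hindA : IndepFun (fun ω => S ω * |S ω|) (ξ n) μ :=
      hind.comp (φ := fun x : ℝ => x * |x|) (ψ := id) (by fun_prop) measurable_id
    have hindB : IndepFun (fun ω => |S ω|) (fun ω => ξ n ω ^ 2) μ :=
      hind.comp (φ := fun x : ℝ => |x|) (ψ := fun x => x ^ 2) (by fun_prop) (by fun_prop)
    have iSS : Integrable (fun ω => S ω * |S ω|) μ := hS2.integrable_mul hS2.abs
    have iS : Integrable (fun ω => |S ω|) μ := (hS2.integrable (by norm_num)).abs
    have i1 := cube hS
    have i2 : Integrable (fun ω => 3 * (S ω * |S ω| * ξ n ω)) μ :=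
      (hindA.integrable_mul iSS ((hL2 n).integrable (by norm_num))).const_mul 3
    have i3 : Integrable (fun ω => 3 * (|S ω| * ξ n ω ^ 2)) μ :=
      (hindB.integrable_mul iS (hL2 n).integrable_sq).const_mul 3
    have i4 := cube (hL n)
    have e2 := hindA.integral_fun_mul_eq_mul_integral iSS.aestronglyMeasurable
      (hL n).aestronglyMeasurable
    rw [h0, mul_zero] at e2
    have e3 := hindB.integral_fun_mul_eq_mul_integral iS.aestronglyMeasurable
      (hL2 n).integrable_sq.aestronglyMeasurable
    have hE : ∫ ω, |S ω| ∂μ ≤ Real.sqrt n * Real.sqrt v := by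
      rw [← Real.sqrt_mul (Nat.cast_nonneg n), ← integral_sum_range_sq hi hL2 h0 hv n]
      exact integral_abs_le_sqrt hS2
    -- Independence and centring remove the linear term, so one step adds only `O(E|S|) = O(√n)`;
    -- these increments sum to order `n ^ (3/2)`.
    have hstep : ∫ ω, |∑ k ∈ Finset.range (n + 1), ξ k ω| ^ 3 ∂μ
        ≤ ∫ ω, |S ω| ^ 3 ∂μ + 3 * ((∫ ω, |S ω| ∂μ) * v) + ρ := by
      calc ∫ ω, |∑ k ∈ Finset.range (n + 1), ξ k ω| ^ 3 ∂μ
          ≤ ∫ ω, (|S ω| ^ 3 + 3 * (S ω * |S ω| * ξ n ω) + 3 * (|S ω| * ξ n ω ^ 2)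
              + |ξ n ω| ^ 3) ∂μ := by
            refine integral_mono (cube (memLp_sum_range hL (n + 1)))
              (((i1.fun_add i2).fun_add i3).fun_add i4) fun ω => ?_
            simp only [Finset.sum_range_succ]
            exact abs_add_pow_three_le (S ω) (ξ n ω)
        _ = _ := by
            rw [integral_add ((i1.fun_add i2).fun_add i3) i4, integral_add (i1.fun_add i2) i3,
              integral_add i1 i2, integral_const_mul, integral_const_mul, e2, e3, hv, hρ]
            ring
    have hsqrt : Real.sqrt n ≤ Real.sqrt (n + 1 : ℕ) := Real.sqrt_le_sqrt (by simp)
    have hone : 1 ≤ Real.sqrt (n + 1 : ℕ) := by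
      rw [Real.one_le_sqrt]
      simp
    have hn0 := Real.sqrt_nonneg (n : ℝ)
    have hnn : (0 : ℝ) ≤ n := Nat.cast_nonneg n
    have hvv : 0 ≤ Real.sqrt v * v := by positivity
    have h3 : (∫ ω, |S ω| ∂μ) * v ≤ Real.sqrt n * (Real.sqrt v * v) := by
      rw [← mul_assoc]
      exact mul_le_mul_of_nonneg_right hE hv0
    have hC : 0 ≤ 3 * (Real.sqrt v * v) + ρ := by positivity
    calc _ ≤ (3 * (Real.sqrt v * v) + ρ) * (n * Real.sqrt n)
          + 3 * (Real.sqrt n * (Real.sqrt v * v)) + ρ := by linarith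
      _ ≤ (3 * (Real.sqrt v * v) + ρ) * (n * Real.sqrt (n + 1 : ℕ))
          + 3 * (Real.sqrt (n + 1 : ℕ) * (Real.sqrt v * v)) + ρ * Real.sqrt (n + 1 : ℕ) := by
          gcongr
          exact le_mul_of_one_le_right hρ0 hone
      _ = _ := by push_cast; ring

end Sums

/-! ### Empirical averages -/

/-- Average of `f` over the first `N` terms of `s`. -/
noncomputable def empAvg {U : Type*} (f : U → ℝ) (s : ℕ → U) (N : ℕ) : ℝ :=
  (1 / (N : ℝ)) * ∑ n ∈ Finset.range N, f (s n)

theorem empAvg_sub_const {U : Type*} (f : U → ℝ) (c : ℝ) (s : ℕ → U) {N : ℕ} (hN : N ≠ 0) :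
    empAvg (fun v => f v - c) s N = empAvg f s N - c := by
  simp only [empAvg, Finset.sum_sub_distrib, Finset.sum_const, Finset.card_range, nsmul_eq_mul]
  field_simp

section Averages

variable {U : Type*} [MeasurableSpace U] {p : Measure U}
  {Ω : Type*} [MeasurableSpace Ω] {μ : Measure Ω}
  {u : ℕ → Ω → U}

theorem memLp_empAvg (hu : ∀ n, MeasurePreserving (u n) μ p) {f : U → ℝ} {q : ENNReal}
    (hf : MemLp f q p) (N : ℕ) : MemLp (fun ω => empAvg f (fun n => u n ω) N) q μ :=
  (memLp_sum_range (fun n => hf.comp_measurePreserving (hu n)) N).const_mul _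

theorem integral_comp_sample (hu : ∀ n, MeasurePreserving (u n) μ p) {f : U → ℝ}
    (hf : AEStronglyMeasurable f p) (n : ℕ) : ∫ ω, f (u n ω) ∂μ = ∫ v, f v ∂p := by
  rw [← (hu n).map_eq] at hf ⊢
  exact (integral_map (hu n).aemeasurable hf).symm

theorem iIndepFun_comp_sample (hu : ∀ n, MeasurePreserving (u n) μ p) (hi : iIndepFun u μ)
    {f : U → ℝ} (hf : AEMeasurable f p) : iIndepFun (fun n ω => f (u n ω)) μ :=
  hi.comp₀ (fun _ => f) (fun n => (hu n).aemeasurable) fun n => by rwa [(hu n).map_eq]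

theorem integral_empAvg_sq (hu : ∀ n, MeasurePreserving (u n) μ p) (hi : iIndepFun u μ)
    {f : U → ℝ} (hf : MemLp f 2 p) (h0 : ∫ v, f v ∂p = 0) (N : ℕ) :
    ∫ ω, empAvg f (fun n => u n ω) N ^ 2 ∂μ = (∫ v, f v ^ 2 ∂p) / N := by
  have h := integral_sum_range_sq (iIndepFun_comp_sample hu hi hf.aemeasurable)
    (fun n => hf.comp_measurePreserving (hu n))
    (fun n => (integral_comp_sample hu hf.aestronglyMeasurable n).trans h0)
    (fun n => integral_comp_sample hu (f := fun v => f v ^ 2) hf.integrable_sq.1 n) N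
  simp only [empAvg, mul_pow, integral_const_mul, h]
  rcases eq_or_ne N 0 with rfl | hN
  · simp
  · field_simp

theorem integral_abs_empAvg_pow_three_le [IsProbabilityMeasure μ] [IsProbabilityMeasure p]
    (hu : ∀ n, MeasurePreserving (u n) μ p)
    (hi : iIndepFun u μ) {f : U → ℝ} (hf : MemLp f 3 p) (h0 : ∫ v, f v ∂p = 0) :
    ∃ C : ℝ, ∀ N : ℕ,
      ∫ ω, |empAvg f (fun n => u n ω) N| ^ 3 ∂μ ≤ C * (N : ℝ) ^ (-(3 / 2) : ℝ) := by
  have hf2 : MemLp f 2 p := hf.mono_exponent (by norm_num)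
  have hf3 : Integrable (fun v => |f v| ^ 3) p := by
    simpa using MemLp.integrable_norm_pow (p := 3) hf (by norm_num)
  refine ⟨3 * (Real.sqrt (∫ v, f v ^ 2 ∂p) * ∫ v, f v ^ 2 ∂p) + ∫ v, |f v| ^ 3 ∂p, fun N => ?_⟩
  have h := integral_abs_sum_range_pow_three_le (iIndepFun_comp_sample hu hi hf.aemeasurable)
    (fun n => hf.comp_measurePreserving (hu n))
    (fun n => (integral_comp_sample hu hf.aestronglyMeasurable n).trans h0)
    (fun n => integral_comp_sample hu (f := fun v => f v ^ 2) hf2.integrable_sq.1 n)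
    (fun n => integral_comp_sample hu (f := fun v => |f v| ^ 3) hf3.1 n) N
  -- At `N = 0` both sides vanish: `1 / 0 = 0` and `0 ^ (-3/2) = 0`.
  rcases eq_or_ne N 0 with rfl | hN
  · simp [empAvg, Real.zero_rpow]
  have hN0 : (0 : ℝ) < N := by positivity
  have hpow : (1 / (N : ℝ)) ^ 3 * (N * Real.sqrt N) = (N : ℝ) ^ (-(3 / 2) : ℝ) := by
    rw [Real.sqrt_eq_rpow, one_div, inv_pow, ← Real.rpow_natCast, ← Real.rpow_neg hN0.le]
    nth_rw 2 [← Real.rpow_one (N : ℝ)]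
    rw [← Real.rpow_add hN0, ← Real.rpow_add hN0]
    norm_num
  simp only [empAvg, abs_mul, mul_pow, integral_const_mul]
  rw [abs_of_nonneg (by positivity : (0 : ℝ) ≤ 1 / N)]
  refine (mul_le_mul_of_nonneg_left h (by positivity)).trans_eq ?_
  rw [← hpow]
  ring

/-- Allows a single scalar to control all deviations at once; the power mean inequality reduces the
cube of the sum to the individual cubes. -/
theorem integral_sum_abs_empAvg_pow_three_le [IsProbabilityMeasure μ] [IsProbabilityMeasure p]
    {ι : Type*} [Fintype ι]
    (hu : ∀ n, MeasurePreserving (u n) μ p) (hi : iIndepFun u μ) {F : ι → U → ℝ}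
    (hF : ∀ k, MemLp (F k) 3 p) (h0 : ∀ k, ∫ v, F k v ∂p = 0) :
    ∃ C : ℝ, ∀ N : ℕ,
      ∫ ω, (∑ k, |empAvg (F k) (fun n => u n ω) N|) ^ 3 ∂μ ≤ C * (N : ℝ) ^ (-(3 / 2) : ℝ) := by
  choose C hC using fun k => integral_abs_empAvg_pow_three_le hu hi (hF k) (h0 k)
  have cube : ∀ {f : Ω → ℝ}, MemLp f 3 μ → Integrable (fun ω => |f ω| ^ 3) μ := fun {f} hf => by
    simpa using MemLp.integrable_norm_pow (p := 3) hf (by norm_num)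
  refine ⟨(Fintype.card ι : ℝ) ^ 2 * ∑ k, C k, fun N => ?_⟩
  have hint : ∀ k, Integrable (fun ω => |empAvg (F k) (fun n => u n ω) N| ^ 3) μ :=
    fun k => cube (memLp_empAvg hu (hF k) N)
  calc _ ≤ ∫ ω, (Fintype.card ι : ℝ) ^ 2 * ∑ k, |empAvg (F k) (fun n => u n ω) N| ^ 3 ∂μ := by
        refine integral_mono_of_nonneg (ae_of_all _ fun ω => by positivity)
          ((integrable_finsetSum _ fun k _ => hint k).const_mul _) (ae_of_all _ fun ω => ?_)
        exact pow_sum_le_card_mul_sum_pow (fun k _ => abs_nonneg _) 2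
    _ = (Fintype.card ι : ℝ) ^ 2 * ∑ k, ∫ ω, |empAvg (F k) (fun n => u n ω) N| ^ 3 ∂μ := by
        rw [integral_const_mul, integral_finsetSum _ fun k _ => hint k]
    _ ≤ (Fintype.card ι : ℝ) ^ 2 * ∑ k, C k * (N : ℝ) ^ (-(3 / 2) : ℝ) := by
        gcongr with k
        exact hC k N
    _ = _ := by rw [← Finset.sum_mul, mul_assoc]

end Averages

/-! ### The pseudo-inverse of a symmetric matrix -/

theorem IsPseudoInverse.transpose {K : ℕ} {A B : Matrix (Fin K) (Fin K) ℝ}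
    (h : IsPseudoInverse A B) : IsPseudoInverse Aᵀ Bᵀ where
  mul_mul_self := by rw [← transpose_mul, ← transpose_mul, ← Matrix.mul_assoc, h.mul_mul_self]
  self_mul_mul := by rw [← transpose_mul, ← transpose_mul, ← Matrix.mul_assoc, h.self_mul_mul]
  left_symm := by rw [← transpose_mul, h.right_symm, h.right_symm]
  right_symm := by rw [← transpose_mul, h.left_symm, h.left_symm]

/-- The Penrose equations are stable under transposition, so uniqueness gives symmetry. -/
theorem transpose_pinv {K : ℕ} {A : Matrix (Fin K) (Fin K) ℝ} (hA : Aᵀ = A) :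
    (pinv A)ᵀ = pinv A := by
  have h := (isPseudoInverse_pinv hA).transpose
  rw [hA] at h
  exact h.unique (isPseudoInverse_pinv hA)

/-- Tikhonov regularization converges to the pseudo-inverse. -/
theorem tendsto_regularized_inv {K : ℕ} {A : Matrix (Fin K) (Fin K) ℝ} (hA : Aᵀ = A) :
    Tendsto (fun k : ℕ => (A * A + (1 / ((k : ℝ) + 1)) • (1 : Matrix (Fin K) (Fin K) ℝ))⁻¹ * A)
      atTop (nhds (pinv A)) := by
  have hH : A.IsHermitian := by
    rw [Matrix.IsHermitian, Matrix.conjTranspose_eq_transpose_of_trivial, hA]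
  obtain ⟨U, d, hU, hAd⟩ : ∃ (U : Matrix (Fin K) (Fin K) ℝ) (d : Fin K → ℝ),
      Uᵀ * U = 1 ∧ A = U * Matrix.diagonal d * Uᵀ := by
    refine ⟨hH.eigenvectorUnitary, hH.eigenvalues, ?_, ?_⟩
    · have := Unitary.coe_star_mul_self hH.eigenvectorUnitary
      rwa [Matrix.star_eq_conjTranspose, Matrix.conjTranspose_eq_transpose_of_trivial] at this
    · have := hH.spectral_theorem
      rw [Unitary.conjStarAlgAut_apply, Matrix.star_eq_conjTranspose,
        Matrix.conjTranspose_eq_transpose_of_trivial] at this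
      simpa using this
  have hU' : U * Uᵀ = 1 := mul_eq_one_comm.1 hU
  have key : ∀ a b : Fin K → ℝ, (U * Matrix.diagonal a * Uᵀ) * (U * Matrix.diagonal b * Uᵀ)
      = U * Matrix.diagonal (fun i => a i * b i) * Uᵀ := by
    intro a b
    calc _ = U * Matrix.diagonal a * (Uᵀ * U) * Matrix.diagonal b * Uᵀ := by
          simp only [Matrix.mul_assoc]
      _ = _ := by
          rw [hU, Matrix.mul_one, Matrix.mul_assoc U, Matrix.diagonal_mul_diagonal]
  have hT : ∀ a : Fin K → ℝ, (U * Matrix.diagonal a * Uᵀ)ᵀ = U * Matrix.diagonal a * Uᵀ := by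
    intro a
    simp [Matrix.transpose_mul, Matrix.mul_assoc]
  have hpinv : pinv A = U * Matrix.diagonal (fun i => (d i)⁻¹) * Uᵀ := by
    refine (isPseudoInverse_pinv hA).unique ?_
    rw [hAd]
    refine ⟨?_, ?_, ?_, ?_⟩
    · rw [key, key]; congr; funext i; exact mul_inv_mul_cancel (d i)
    · rw [key, key]; congr; funext i
      simpa using mul_inv_mul_cancel (d i)⁻¹
    · rw [key, hT]
    · rw [key, hT]
  have hreg : ∀ δ : ℝ, 0 < δ → (A * A + δ • (1 : Matrix (Fin K) (Fin K) ℝ))⁻¹ * A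
      = U * Matrix.diagonal (fun i => (d i * d i + δ)⁻¹ * d i) * Uᵀ := by
    intro δ hδ
    have h1 : A * A + δ • (1 : Matrix (Fin K) (Fin K) ℝ)
        = U * Matrix.diagonal (fun i => d i * d i + δ) * Uᵀ := by
      have : Matrix.diagonal (fun i => d i * d i + δ)
          = Matrix.diagonal (fun i => d i * d i) + δ • (1 : Matrix (Fin K) (Fin K) ℝ) := by
        rw [Matrix.smul_one_eq_diagonal, Matrix.diagonal_add]
      rw [this, hAd, key, Matrix.mul_add, Matrix.add_mul, Matrix.mul_smul, Matrix.smul_mul,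
        Matrix.mul_one, hU']
    have h2 : (A * A + δ • (1 : Matrix (Fin K) (Fin K) ℝ))⁻¹
        = U * Matrix.diagonal (fun i => (d i * d i + δ)⁻¹) * Uᵀ := by
      refine Matrix.inv_eq_left_inv ?_
      have h3 : (fun i => (d i * d i + δ)⁻¹ * (d i * d i + δ)) = fun _ => (1 : ℝ) := by
        funext i
        exact inv_mul_cancel₀ (by nlinarith [mul_self_nonneg (d i)])
      rw [h1, key, h3, Matrix.diagonal_one, Matrix.mul_one, hU']
    rw [h2, ← key, ← hAd]
  have hlim : Tendsto (fun k : ℕ => fun i => (d i * d i + 1 / ((k : ℝ) + 1))⁻¹ * d i) atTop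
      (nhds fun i => (d i)⁻¹) := by
    refine tendsto_pi_nhds.2 fun i => ?_
    -- On a zero eigenvalue the regularized value is `0` for every `k`, matching the convention `0⁻¹
    -- = 0` that the pseudo-inverse requires.
    rcases eq_or_ne (d i) 0 with h | h
    · simp [h]
    · have h1 : Tendsto (fun k : ℕ => d i * d i + 1 / ((k : ℝ) + 1)) atTop
          (nhds (d i * d i + 0)) := tendsto_const_nhds.add tendsto_one_div_add_atTop_nhds_zero_nat
      rw [add_zero] at h1
      have h2 := (h1.inv₀ (mul_ne_zero h h)).mul_const (d i)
      rwa [mul_inv, mul_assoc, inv_mul_cancel₀ h, mul_one] at h2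
  have hcont : Continuous fun a : Fin K → ℝ => U * Matrix.diagonal a * Uᵀ := by fun_prop
  rw [hpinv]
  refine ((hcont.tendsto _).comp hlim).congr fun k => ?_
  exact (hreg _ (by positivity)).symm

/-- Measurability of the quadratic form of the pseudo-inverse. -/
theorem aemeasurable_pinv_quadratic {K : ℕ} {Ω : Type*} [MeasurableSpace Ω] {μ : Measure Ω}
    {A : Ω → Matrix (Fin K) (Fin K) ℝ} {R : Ω → Fin K → ℝ} (hA : ∀ ω, (A ω)ᵀ = A ω)
    (hAm : ∀ i j, AEMeasurable (fun ω => A ω i j) μ) (hRm : ∀ i, AEMeasurable (fun ω => R ω i) μ) :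
    AEMeasurable (fun ω => R ω ⬝ᵥ (pinv (A ω) *ᵥ R ω)) μ := by
  have hpair : AEMeasurable (fun ω => ((fun i j => A ω i j : Fin K → Fin K → ℝ), R ω)) μ :=
    (aemeasurable_pi_lambda _ fun i => aemeasurable_pi_lambda _ fun j => hAm i j).prodMk
      (aemeasurable_pi_lambda _ hRm)
  -- `pinv` is discontinuous where the rank changes, so measurability comes from a pointwise limit.
  -- Each regularized inverse is `det⁻¹` times the adjugate, both continuous in the entries.
  refine aemeasurable_of_tendsto_metrizable_ae atTop
    (f := fun (k : ℕ) ω => R ω ⬝ᵥ (((A ω * A ω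
      + (1 / ((k : ℝ) + 1)) • (1 : Matrix (Fin K) (Fin K) ℝ))⁻¹ * A ω) *ᵥ R ω))
    (fun k => ?_) (ae_of_all _ fun ω => ?_)
  · have h1 : Continuous fun z : (Fin K → Fin K → ℝ) × (Fin K → ℝ) =>
        (Matrix.of z.1 * Matrix.of z.1
          + (1 / ((k : ℝ) + 1)) • (1 : Matrix (Fin K) (Fin K) ℝ)).det := by
      have : Continuous fun z : (Fin K → Fin K → ℝ) × (Fin K → ℝ) => Matrix.of z.1 :=
        continuous_fst
      fun_prop
    have h2 : Continuous fun z : (Fin K → Fin K → ℝ) × (Fin K → ℝ) =>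
        z.2 ⬝ᵥ (((Matrix.of z.1 * Matrix.of z.1
          + (1 / ((k : ℝ) + 1)) • (1 : Matrix (Fin K) (Fin K) ℝ)).adjugate * Matrix.of z.1)
            *ᵥ z.2) := by
      have : Continuous fun z : (Fin K → Fin K → ℝ) × (Fin K → ℝ) => Matrix.of z.1 :=
        continuous_fst
      fun_prop
    refine ((h1.measurable.comp_aemeasurable hpair).inv.mul
      (h2.measurable.comp_aemeasurable hpair)).congr (ae_of_all _ fun ω => ?_)
    have hof : Matrix.of (fun i j => A ω i j) = A ω := rfl
    simp only [Pi.mul_apply, Pi.inv_apply, Function.comp, hof]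
    rw [Matrix.inv_def, Ring.inverse_eq_inv', Matrix.smul_mul, Matrix.smul_mulVec,
      dotProduct_smul, smul_eq_mul]
  · have hc : Continuous fun B : Matrix (Fin K) (Fin K) ℝ => R ω ⬝ᵥ (B *ᵥ R ω) := by fun_prop
    exact (hc.tendsto _).comp (tendsto_regularized_inv (hA ω))

/-- Completing the square: the quadratic form of the pseudo-inverse is a value of the quadratic
form of the matrix. -/
theorem pinv_quadratic_eq {K : ℕ} {A : Matrix (Fin K) (Fin K) ℝ} (hA : Aᵀ = A) (R : Fin K → ℝ) :
    R ⬝ᵥ (pinv A *ᵥ R) = (pinv A *ᵥ R) ⬝ᵥ (A *ᵥ (pinv A *ᵥ R)) := by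
  have h := (isPseudoInverse_pinv hA).self_mul_mul
  nth_rw 1 [← h]
  rw [Matrix.mul_assoc, ← mulVec_mulVec, dotProduct_mulVec, ← mulVec_transpose, transpose_pinv hA,
    mulVec_mulVec]

/-! ### Quadratic forms near an invertible matrix -/

theorem abs_quadratic_le {K : ℕ} (M : Matrix (Fin K) (Fin K) ℝ) {R : Fin K → ℝ} {t : ℝ}
    (hR : ∀ i, |R i| ≤ t) : |R ⬝ᵥ (M *ᵥ R)| ≤ (∑ i, ∑ j, |M i j|) * t ^ 2 := by
  simp only [dotProduct, mulVec, Finset.mul_sum, Finset.sum_mul]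
  refine (Finset.abs_sum_le_sum_abs _ _).trans (Finset.sum_le_sum fun i _ => ?_)
  refine (Finset.abs_sum_le_sum_abs _ _).trans (Finset.sum_le_sum fun j _ => ?_)
  have ht : 0 ≤ t := (abs_nonneg _).trans (hR i)
  rw [abs_mul, abs_mul]
  calc |R i| * (|M i j| * |R j|) ≤ t * (|M i j| * t) := by
        gcongr
        · exact hR i
        · exact hR j
    _ = _ := by ring

section InverseLipschitz

attribute [local instance] Matrix.linftyOpNormedRing Matrix.linftyOpNormedAlgebra

/-- With the next lemma, this lets entrywise bounds pass to and from a submultiplicative norm, in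
which the expansion of inversion at a unit is available. -/
theorem abs_entry_le_norm {K : ℕ} (M : Matrix (Fin K) (Fin K) ℝ) (i j : Fin K) :
    |M i j| ≤ ‖M‖ := by
  rw [Matrix.linfty_opNorm_def]
  calc |M i j| = ((‖M i j‖₊ : NNReal) : ℝ) := by simp
    _ ≤ _ := by
      norm_cast
      exact (Finset.single_le_sum (f := fun j => ‖M i j‖₊) (fun _ _ => zero_le)
        (Finset.mem_univ j)).trans (Finset.le_sup (f := fun i => ∑ j, ‖M i j‖₊)
          (Finset.mem_univ i))

theorem norm_le_of_abs_entry_le {K : ℕ} {M : Matrix (Fin K) (Fin K) ℝ} {t : ℝ} (ht : 0 ≤ t)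
    (hM : ∀ i j, |M i j| ≤ t) : ‖M‖ ≤ K * t := by
  lift t to NNReal using ht
  rw [Matrix.linfty_opNorm_def]
  norm_cast
  refine Finset.sup_le fun i _ => ?_
  refine (Finset.sum_le_card_nsmul _ _ t fun j _ => ?_).trans_eq ?_
  · rw [← NNReal.coe_le_coe]
    simpa using hM i j
  · simp

/-- Matrix inversion is Lipschitz near an invertible matrix. -/
theorem exists_inv_lipschitz {K : ℕ} {G : Matrix (Fin K) (Fin K) ℝ} (hG : IsUnit G.det) :
    ∃ ε > 0, ∃ c ≥ 0, ∀ (A : Matrix (Fin K) (Fin K) ℝ) (t : ℝ), 0 ≤ t → t < ε →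
      (∀ i j, |A i j - G i j| ≤ t) →
        IsUnit A.det ∧ ∀ i j, |A⁻¹ i j - G⁻¹ i j| ≤ c * t := by
  obtain ⟨g, rfl⟩ := (Matrix.isUnit_iff_isUnit_det G).2 hG
  have h1 := NormedRing.inverse_add_norm_diff_first_order g
  obtain ⟨c, hc0, hc⟩ := h1.exists_nonneg
  have h2 : ∀ᶠ s in nhds (0 : Matrix (Fin K) (Fin K) ℝ),
      IsUnit ((g : Matrix (Fin K) (Fin K) ℝ) + s) := by
    have : Tendsto (fun s => (g : Matrix (Fin K) (Fin K) ℝ) + s) (nhds 0) (nhds ↑g) :=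
      (continuous_const.add continuous_id).tendsto' _ _ (by simp)
    exact this (Units.nhds g)
  obtain ⟨r, hr, hball⟩ := Metric.eventually_nhds_iff.1 (hc.bound.and h2)
  -- Entries below `r / (K + 1)` give norm at most `K * t < r`; the `+ 1` covers `K = 0`.
  refine ⟨r / (K + 1), by positivity, c * K, by positivity, fun A t ht htr hA => ?_⟩
  have hn : ‖A - g‖ ≤ K * t := norm_le_of_abs_entry_le ht hA
  have hlt : ‖A - g‖ < r := by
    rw [lt_div_iff₀ (by positivity)] at htr
    nlinarith
  obtain ⟨hb, hu⟩ := hball (y := A - g) (by rwa [dist_zero_right])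
  rw [add_sub_cancel] at hb hu
  refine ⟨(Matrix.isUnit_iff_isUnit_det A).1 hu, fun i j => ?_⟩
  have hgi : ((g⁻¹ : (Matrix (Fin K) (Fin K) ℝ)ˣ) : Matrix (Fin K) (Fin K) ℝ)
      = (g : Matrix (Fin K) (Fin K) ℝ)⁻¹ := Matrix.coe_units_inv g
  rw [← Matrix.nonsing_inv_eq_ringInverse, norm_norm] at hb
  calc _ = |(A⁻¹ - (g : Matrix (Fin K) (Fin K) ℝ)⁻¹) i j| := rfl
    _ ≤ ‖A⁻¹ - (g : Matrix (Fin K) (Fin K) ℝ)⁻¹‖ := abs_entry_le_norm _ i j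
    _ ≤ c * ‖A - g‖ := by rw [← hgi]; exact hb
    _ ≤ c * (K * t) := by gcongr
    _ = _ := by ring

end InverseLipschitz

/-- Third-order comparison of the quadratic form of the pseudo-inverse with that of the inverse of
a nearby invertible matrix. -/
theorem exists_pinv_quadratic_sub_le {K : ℕ} {G : Matrix (Fin K) (Fin K) ℝ} (hG : IsUnit G.det)
    {m : ℝ} (hm : 0 ≤ m) :
    ∃ C : ℝ, ∀ (A : Matrix (Fin K) (Fin K) ℝ) (R : Fin K → ℝ) (t : ℝ), Aᵀ = A → 0 ≤ t →
      (∀ i j, |A i j - G i j| ≤ t) → (∀ i, |R i| ≤ t) → 0 ≤ R ⬝ᵥ (pinv A *ᵥ R) →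
        R ⬝ᵥ (pinv A *ᵥ R) ≤ m + t →
          |R ⬝ᵥ (pinv A *ᵥ R) - R ⬝ᵥ (G⁻¹ *ᵥ R)| ≤ C * t ^ 3 := by
  obtain ⟨ε, hε, c, hc, hinv⟩ := exists_inv_lipschitz hG
  set g : ℝ := ∑ i, ∑ j, |G⁻¹ i j|
  have hg : 0 ≤ g := Finset.sum_nonneg fun i _ => Finset.sum_nonneg fun j _ => abs_nonneg _
  -- The first summand serves `t < ε`. The others serve `t ≥ ε`, where `m`, `t` and `g * t ^ 2` are
  -- raised to order `t ^ 3` by powers of `t / ε ≥ 1`.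
  refine ⟨K * (K * c) + (m / ε ^ 3 + 1 / ε ^ 2 + g / ε), fun A R t hA ht hAG hR h0 hle => ?_⟩
  have hfar : 0 ≤ m / ε ^ 3 + 1 / ε ^ 2 + g / ε := by positivity
  have hnear : 0 ≤ K * (K * c) := by positivity
  have ht3 : 0 ≤ t ^ 3 := by positivity
  rcases lt_or_ge t ε with htε | htε
  · obtain ⟨hu, hd⟩ := hinv A t ht htε hAG
    rw [pinv_eq_inv hA hu, ← dotProduct_sub, ← sub_mulVec]
    refine (abs_quadratic_le _ hR).trans ?_
    have hs : ∑ i, ∑ j, |(A⁻¹ - G⁻¹) i j| ≤ K * (K * (c * t)) := by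
      refine (Finset.sum_le_card_nsmul _ _ (K * (c * t)) fun i _ => ?_).trans_eq (by simp)
      exact (Finset.sum_le_card_nsmul _ _ (c * t) fun j _ => hd i j).trans_eq (by simp)
    calc _ ≤ K * (K * (c * t)) * t ^ 2 := by gcongr
      _ = K * (K * c) * t ^ 3 := by ring
      _ ≤ _ := by nlinarith
  · have h1 : |R ⬝ᵥ (G⁻¹ *ᵥ R)| ≤ g * t ^ 2 := abs_quadratic_le _ hR
    have hq : 1 ≤ t / ε := (one_le_div hε).2 htε
    have e1 : m ≤ m / ε ^ 3 * t ^ 3 := by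
      calc m ≤ m * (t / ε) ^ 3 := le_mul_of_one_le_right hm (one_le_pow₀ hq)
        _ = _ := by rw [div_pow]; ring
    have e2 : t ≤ 1 / ε ^ 2 * t ^ 3 := by
      calc t ≤ t * (t / ε) ^ 2 := le_mul_of_one_le_right ht (one_le_pow₀ hq)
        _ = _ := by rw [div_pow]; ring
    have e3 : g * t ^ 2 ≤ g / ε * t ^ 3 := by
      calc g * t ^ 2 ≤ g * t ^ 2 * (t / ε) := le_mul_of_one_le_right (by positivity) hq
        _ = _ := by ring
    refine (abs_sub _ _).trans ?_
    rw [abs_of_nonneg h0]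
    nlinarith [mul_nonneg hnear ht3]

/-! ### Deterministic properties of the empirical quantities -/

section Deterministic

variable {U : Type*} {K : ℕ}

theorem transpose_empGram (X : Fin K → U → ℝ) (s : ℕ → U) (N : ℕ) :
    (empGram X s N)ᵀ = empGram X s N := by
  ext i j
  simp [empGram, mul_comm]

theorem empAvg_nonneg {f : U → ℝ} (hf : ∀ v, 0 ≤ f v) (s : ℕ → U) (N : ℕ) :
    0 ≤ empAvg f s N :=
  mul_nonneg (by positivity) (Finset.sum_nonneg fun _ _ => hf _)

theorem empAvg_add (f g : U → ℝ) (s : ℕ → U) (N : ℕ) :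
    empAvg (fun v => f v + g v) s N = empAvg f s N + empAvg g s N := by
  simp [empAvg, Finset.sum_add_distrib, mul_add]

theorem empAvg_const_mul (c : ℝ) (f : U → ℝ) (s : ℕ → U) (N : ℕ) :
    empAvg (fun v => c * f v) s N = c * empAvg f s N := by
  simp only [empAvg, ← Finset.mul_sum]
  ring

theorem empAvg_sum {ι : Type*} (t : Finset ι) (f : ι → U → ℝ) (s : ℕ → U) (N : ℕ) :
    empAvg (fun v => ∑ i ∈ t, f i v) s N = ∑ i ∈ t, empAvg (f i) s N := by
  simp only [empAvg, ← Finset.mul_sum]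
  rw [Finset.sum_comm]

theorem empGram_quadratic (X : Fin K → U → ℝ) (s : ℕ → U) (N : ℕ) (W : Fin K → ℝ) :
    W ⬝ᵥ (empGram X s N *ᵥ W) = empAvg (fun v => (∑ i, W i * X i v) ^ 2) s N := by
  have h : ∀ v, (∑ i, W i * X i v) ^ 2 = ∑ i, ∑ j, W i * W j * (X i v * X j v) := fun v => by
    rw [sq, Finset.sum_mul_sum]
    exact Finset.sum_congr rfl fun i _ => Finset.sum_congr rfl fun j _ => by ring
  simp only [h, empAvg_sum, empAvg_const_mul, dotProduct, mulVec, Finset.mul_sum]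
  refine Finset.sum_congr rfl fun i _ => Finset.sum_congr rfl fun j _ => ?_
  change W i * (empAvg (fun v => X i v * X j v) s N * W j) = _
  ring

theorem dotProduct_empCorr (X : Fin K → U → ℝ) (y : U → ℝ) (s : ℕ → U) (N : ℕ) (W : Fin K → ℝ) :
    W ⬝ᵥ empCorr X y s N = empAvg (fun v => (∑ i, W i * X i v) * y v) s N := by
  simp only [Finset.sum_mul, mul_assoc, empAvg_sum, empAvg_const_mul]
  rfl

theorem pinv_empGram_quadratic_nonneg (X : Fin K → U → ℝ) (s : ℕ → U) (N : ℕ) (R : Fin K → ℝ) :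
    0 ≤ R ⬝ᵥ (pinv (empGram X s N) *ᵥ R) := by
  rw [pinv_quadratic_eq (transpose_empGram X s N), empGram_quadratic]
  exact empAvg_nonneg (fun v => sq_nonneg _) s N

/-- The squared length of the projection of the target samples on the readout samples is at most
that of the target samples. -/
theorem pinv_empGram_quadratic_le (X : Fin K → U → ℝ) (y : U → ℝ) (s : ℕ → U) (N : ℕ) :
    empCorr X y s N ⬝ᵥ (pinv (empGram X s N) *ᵥ empCorr X y s N)
      ≤ empAvg (fun v => y v ^ 2) s N := by
  set R := empCorr X y s N with hR
  set W := pinv (empGram X s N) *ᵥ R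
  have h1 : R ⬝ᵥ W = empAvg (fun v => (∑ i, W i * X i v) ^ 2) s N := by
    rw [← empGram_quadratic]
    exact pinv_quadratic_eq (transpose_empGram X s N) R
  have h2 : R ⬝ᵥ W = empAvg (fun v => (∑ i, W i * X i v) * y v) s N := by
    rw [dotProduct_comm, hR, dotProduct_empCorr]
  -- `h1` and `h2` are the normal equations tested on `W`, valid even for a singular Gram matrix;
  -- the residual mean square is then the empirical mean of `y ^ 2` minus `R ⬝ᵥ W`.
  have h3 := empAvg_nonneg (fun v => sq_nonneg ((∑ i, W i * X i v) - y v)) s N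
  have h4 : empAvg (fun v => ((∑ i, W i * X i v) - y v) ^ 2) s N
      = empAvg (fun v => (∑ i, W i * X i v) ^ 2) s N
        + -2 * empAvg (fun v => (∑ i, W i * X i v) * y v) s N
        + empAvg (fun v => y v ^ 2) s N := by
    rw [← empAvg_const_mul, ← empAvg_add, ← empAvg_add]
    congr 1
    funext v
    ring
  linarith

/-- The form is the squared length of `Λᵀ *ᵥ R`, so its expectation needs only the variances of
scalar averages. -/
theorem empCorr_quadratic_mul_transpose (X : Fin K → U → ℝ) (y : U → ℝ) (s : ℕ → U) (N : ℕ)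
    (Λ : Matrix (Fin K) (Fin K) ℝ) :
    empCorr X y s N ⬝ᵥ ((Λ * Λᵀ) *ᵥ empCorr X y s N)
      = ∑ l, empAvg (fun v => transformed X Λ l v * y v) s N ^ 2 := by
  rw [← mulVec_mulVec, dotProduct_mulVec, ← mulVec_transpose, dotProduct]
  refine Finset.sum_congr rfl fun l _ => ?_
  have h : (Λᵀ *ᵥ empCorr X y s N) l = empAvg (fun v => transformed X Λ l v * y v) s N := by
    change (fun i => Λ i l) ⬝ᵥ empCorr X y s N = _
    rw [dotProduct_empCorr]
    simp only [transformed, mul_comm]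
  rw [h, sq]

theorem inv_eq_mul_transpose {G Λ : Matrix (Fin K) (Fin K) ℝ} (h : Λᵀ * G * Λ = 1) :
    G⁻¹ = Λ * Λᵀ := by
  refine Matrix.inv_eq_left_inv ?_
  rw [Matrix.mul_assoc]
  exact mul_eq_one_comm.1 h

end Deterministic

/-! ### Population quantities -/

section Population

variable {U : Type*} [MeasurableSpace U] {p : Measure U} {K : ℕ}

/-- Hölder with `1/6 + 1/6 = 1/3`: the source of the sixth-moment assumption. -/
theorem _root_.MeasureTheory.MemLp.mul_three {f g : U → ℝ} (hf : MemLp f 6 p) (hg : MemLp g 6 p) :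
    MemLp (fun v => f v * g v) 3 p := by
  have : ENNReal.HolderTriple 6 6 3 := ⟨by
    have h : (6 : ENNReal) = 2 * 3 := by norm_num
    rw [h, ENNReal.mul_inv (by norm_num) (by norm_num), ← add_mul, ENNReal.inv_two_add_inv_two,
      one_mul]⟩
  exact hg.mul' hf

/-- Zero capacity makes `W = 0` optimal, so the error cannot decrease along any coordinate axis and
its derivative there, `-2 * E[X i * y]`, vanishes. -/
theorem integral_mul_eq_zero_of_capacity_eq_zero [IsProbabilityMeasure p] {X : Fin K → U → ℝ}
    {y : U → ℝ} (hX : ∀ i, MemLp (X i) 2 p) (hy : MemLp y 2 p) (hy0 : 0 < ∫ v, y v ^ 2 ∂p)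
    (hC : capacity p X y = 0) (i : Fin K) : ∫ v, X i v * y v ∂p = 0 := by
  have hmin : minMse p X y = ∫ v, y v ^ 2 ∂p := by
    rw [capacity, sub_eq_zero, eq_comm, div_eq_one_iff_eq hy0.ne'] at hC
    exact hC
  have hbdd : BddBelow (Set.range fun W => mse p X y W) :=
    ⟨0, by rintro _ ⟨W, rfl⟩; exact integral_nonneg fun v => sq_nonneg _⟩
  set r := ∫ v, X i v * y v ∂p
  set q := ∫ v, X i v ^ 2 ∂p
  have hq : 0 ≤ q := integral_nonneg fun v => sq_nonneg _
  have hquad : ∀ a : ℝ, 0 ≤ a ^ 2 * q - 2 * a * r := by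
    intro a
    have h1 : minMse p X y ≤ mse p X y (Pi.single i a) := ciInf_le hbdd _
    have h2 : mse p X y (Pi.single i a) = a ^ 2 * q + -2 * a * r + ∫ v, y v ^ 2 ∂p := by
      have i1 : Integrable (fun v => a ^ 2 * X i v ^ 2) p := (hX i).integrable_sq.const_mul _
      have i2 : Integrable (fun v => -2 * a * (X i v * y v)) p :=
        ((hX i).integrable_mul hy).const_mul _
      rw [← integral_const_mul, ← integral_const_mul, ← integral_add i1 i2,
        ← integral_add (i1.fun_add i2) hy.integrable_sq]
      refine integral_congr_ae (ae_of_all _ fun v => ?_)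
      have h3 : ∑ j, Pi.single (M := fun _ => ℝ) i a j * X j v = a * X i v := by
        rw [Finset.sum_eq_single i (fun j _ hj => by simp [hj]) (by simp)]
        simp
      simp only [h3]
      ring
    linarith
  -- The minimizer would be `r / q`; the `+ 1` avoids treating `q = 0` separately and still gives a
  -- negative value unless `r = 0`.
  have h := hquad (r / (q + 1))
  have hq1 : 0 < q + 1 := by positivity
  have e : (r / (q + 1)) ^ 2 * q - 2 * (r / (q + 1)) * r = -(r ^ 2 * (q + 2)) / (q + 1) ^ 2 := by
    field_simp
    ring
  rw [e, le_div_iff₀ (by positivity), zero_mul] at h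
  have : r ^ 2 ≤ 0 := by nlinarith [sq_nonneg r]
  exact pow_eq_zero_iff two_ne_zero |>.1 (le_antisymm this (sq_nonneg r))

theorem memLp_transformed {X : Fin K → U → ℝ} {q : ENNReal} (hX : ∀ i, MemLp (X i) q p)
    (Λ : Matrix (Fin K) (Fin K) ℝ) (l : Fin K) : MemLp (transformed X Λ l) q p :=
  memLp_finsetSum _ fun i _ => (hX i).mul_const (Λ i l)

/-- Cauchy-Schwarz inequality. -/
theorem integral_mul_le_sqrt {f g : U → ℝ} (hf : MemLp f 2 p) (hg : MemLp g 2 p)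
    (hf0 : ∀ v, 0 ≤ f v) (hg0 : ∀ v, 0 ≤ g v) :
    ∫ v, f v * g v ∂p ≤ Real.sqrt ((∫ v, f v ^ 2 ∂p) * ∫ v, g v ^ 2 ∂p) := by
  have h := integral_mul_le_Lp_mul_Lq_of_nonneg (μ := p) Real.HolderConjugate.two_two
    (ae_of_all _ hf0) (ae_of_all _ hg0) (by simpa using hf) (by simpa using hg)
  rw [Real.sqrt_mul (integral_nonneg fun v => sq_nonneg _), Real.sqrt_eq_rpow, Real.sqrt_eq_rpow]
  simpa using h

theorem Delta_le [IsProbabilityMeasure p] {X : Fin K → U → ℝ} {y : U → ℝ}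
    (hX : ∀ i, MemLp (X i) 6 p) (hy : MemLp y 6 p) (hy0 : 0 < ∫ v, y v ^ 2 ∂p) :
    Delta p X y ≤ Real.sqrt ((∫ v, (∑ i, X i v ^ 2) ^ 2 ∂p) * ∫ v, y v ^ 4 ∂p)
      / ∫ v, y v ^ 2 ∂p := by
  have h2 : ∀ {f : U → ℝ}, MemLp f 6 p → MemLp (fun v => f v ^ 2) 2 p := fun {f} hf => by
    simpa only [sq] using (hf.mul_three hf).mono_exponent (p := 2) (by norm_num)
  have h := integral_mul_le_sqrt (memLp_finsetSum Finset.univ fun i _ => h2 (hX i)) (h2 hy)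
    (fun v => Finset.sum_nonneg fun i _ => sq_nonneg _) (fun v => sq_nonneg _)
  simp only [← pow_mul] at h
  exact div_le_div_of_nonneg_right h hy0.le

end Population

/-! ### The expected empirical capacity -/

section Expectation

variable {U : Type*} [MeasurableSpace U] {p : Measure U} {K : ℕ}
  {X : Fin K → U → ℝ} {y : U → ℝ} {Ω : Type*} [MeasurableSpace Ω] {μ : Measure Ω}
  {u : ℕ → Ω → U}

/-- The projection bound dominates the form by the empirical mean of `y ^ 2`, which is integrable,
so nearly singular Gram matrices do no harm. -/
theorem integrable_pinv_quadratic [IsProbabilityMeasure μ]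
    (hX : ∀ i, MemLp (X i) 6 p) (hy : MemLp y 6 p)
    (hu : ∀ n, MeasurePreserving (u n) μ p) (N : ℕ) :
    Integrable (fun ω => empCorr X y (fun n => u n ω) N ⬝ᵥ
      (pinv (empGram X (fun n => u n ω) N) *ᵥ empCorr X y (fun n => u n ω) N)) μ := by
  have hm : AEMeasurable (fun ω => empCorr X y (fun n => u n ω) N ⬝ᵥ
      (pinv (empGram X (fun n => u n ω) N) *ᵥ empCorr X y (fun n => u n ω) N)) μ :=
    aemeasurable_pinv_quadratic (fun ω => transpose_empGram X _ N)
      (fun i j => (memLp_empAvg hu ((hX i).mul_three (hX j)) N).aemeasurable)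
      (fun i => (memLp_empAvg hu ((hX i).mul_three hy) N).aemeasurable)
  have hy2 : MemLp (fun v => y v ^ 2) 3 p := by simpa only [sq] using hy.mul_three hy
  refine ((memLp_empAvg hu hy2 N).integrable (by norm_num)).mono' hm.aestronglyMeasurable
    (ae_of_all _ fun ω => ?_)
  rw [Real.norm_of_nonneg (pinv_empGram_quadratic_nonneg X _ N _)]
  exact pinv_empGram_quadratic_le X y _ N

/-- The leading term, with no remainder: each `X̃ l * y` is centred, so the square of its empirical
mean has expectation its second moment over `N`. -/
theorem integral_inv_quadratic [IsProbabilityMeasure p]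
    (hX : ∀ i, MemLp (X i) 6 p) (hy : MemLp y 6 p)
    (h0 : ∀ i, ∫ v, X i v * y v ∂p = 0) {Λ : Matrix (Fin K) (Fin K) ℝ}
    (hΛ : Λᵀ * gram p X * Λ = 1) (hu : ∀ n, MeasurePreserving (u n) μ p)
    (hi : iIndepFun u μ) (N : ℕ) :
    Integrable (fun ω => empCorr X y (fun n => u n ω) N ⬝ᵥ
        ((gram p X)⁻¹ *ᵥ empCorr X y (fun n => u n ω) N)) μ ∧
      ∫ ω, empCorr X y (fun n => u n ω) N ⬝ᵥ
        ((gram p X)⁻¹ *ᵥ empCorr X y (fun n => u n ω) N) ∂μ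
        = (∫ v, (∑ i, transformed X Λ i v ^ 2) * y v ^ 2 ∂p) / N := by
  have h3 : ∀ l, MemLp (fun v => transformed X Λ l v * y v) 2 p := fun l =>
    ((memLp_transformed hX Λ l).mul_three hy).mono_exponent (by norm_num)
  have hz : ∀ l, ∫ v, transformed X Λ l v * y v ∂p = 0 := fun l => by
    have : ∀ v, transformed X Λ l v * y v = ∑ i, Λ i l * (X i v * y v) := fun v => by
      rw [transformed, Finset.sum_mul]
      exact Finset.sum_congr rfl fun i _ => by ring
    simp only [this]
    rw [integral_finsetSum _ fun i _ =>
      (((hX i).mul_three hy).integrable (by norm_num)).const_mul _]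
    simp [integral_const_mul, h0]
  have hsq : ∀ l, Integrable
      (fun ω => empAvg (fun v => transformed X Λ l v * y v) (fun n => u n ω) N ^ 2) μ :=
    fun l => (memLp_empAvg hu (h3 l) N).integrable_sq
  simp only [inv_eq_mul_transpose hΛ, empCorr_quadratic_mul_transpose]
  refine ⟨integrable_finsetSum _ fun l _ => hsq l, ?_⟩
  rw [integral_finsetSum _ fun l _ => hsq l]
  simp only [integral_empAvg_sq hu hi (h3 _) (hz _), ← Finset.sum_div, Finset.sum_mul, ← mul_pow]
  rw [integral_finsetSum _ fun l _ => (h3 l).integrable_sq]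

theorem exists_integral_abs_sub_le [IsProbabilityMeasure p] [IsProbabilityMeasure μ]
    (hX : ∀ i, MemLp (X i) 6 p) (hy : MemLp y 6 p)
    (hG : IsUnit (gram p X).det) (h0 : ∀ i, ∫ v, X i v * y v ∂p = 0)
    (hu : ∀ n, MeasurePreserving (u n) μ p) (hi : iIndepFun u μ) :
    ∃ C : ℝ, ∀ N : ℕ, N ≠ 0 →
      ∫ ω, |empCorr X y (fun n => u n ω) N ⬝ᵥ
          (pinv (empGram X (fun n => u n ω) N) *ᵥ empCorr X y (fun n => u n ω) N)
        - empCorr X y (fun n => u n ω) N ⬝ᵥ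
          ((gram p X)⁻¹ *ᵥ empCorr X y (fun n => u n ω) N)| ∂μ
        ≤ C * (N : ℝ) ^ (-(3 / 2) : ℝ) := by
  have hm : 0 ≤ ∫ v, y v ^ 2 ∂p := integral_nonneg fun v => sq_nonneg _
  obtain ⟨C, hC⟩ := exists_pinv_quadratic_sub_le hG hm
  -- The `y ^ 2` component is included to bound the empirical form by `E[y ^ 2] + t` when `t` is
  -- large.
  let f : (Fin K × Fin K) ⊕ Fin K ⊕ Unit → U → ℝ :=
    Sum.elim (fun ij v => X ij.1 v * X ij.2 v)
      (Sum.elim (fun i v => X i v * y v) (fun _ v => y v ^ 2))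
  have hf : ∀ k, MemLp (f k) 3 p := by
    rintro (ij | i | _)
    · exact (hX ij.1).mul_three (hX ij.2)
    · exact (hX i).mul_three hy
    · have : MemLp (fun v => y v ^ 2) 3 p := by simpa only [sq] using hy.mul_three hy
      exact this
  let F : (Fin K × Fin K) ⊕ Fin K ⊕ Unit → U → ℝ := fun k v => f k v - ∫ w, f k w ∂p
  have hF : ∀ k, MemLp (F k) 3 p := fun k => (hf k).sub (memLp_const _)
  have hF0 : ∀ k, ∫ v, F k v ∂p = 0 := fun k => by
    simp only [F]
    rw [integral_sub ((hf k).integrable (by norm_num)) (integrable_const _)]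
    simp
  obtain ⟨D, hD⟩ := integral_sum_abs_empAvg_pow_three_le hu hi hF hF0
  refine ⟨|C| * D, fun N hN => ?_⟩
  set t : Ω → ℝ := fun ω => ∑ k, |empAvg (F k) (fun n => u n ω) N|
  have ht : ∀ ω k, |empAvg (f k) (fun n => u n ω) N - ∫ v, f k v ∂p| ≤ t ω := fun ω k => by
    rw [← empAvg_sub_const _ _ _ hN]
    exact Finset.single_le_sum (f := fun k => |empAvg (F k) (fun n => u n ω) N|)
      (fun _ _ => abs_nonneg _) (Finset.mem_univ k)
  have ht0 : ∀ ω, 0 ≤ t ω := fun ω => Finset.sum_nonneg fun _ _ => abs_nonneg _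
  have htL : MemLp t 3 μ := memLp_finsetSum _ fun k _ => (memLp_empAvg hu (hF k) N).abs
  have ht3 : Integrable (fun ω => t ω ^ 3) μ := by
    have := MemLp.integrable_norm_pow (p := 3) htL (by norm_num)
    refine this.congr (ae_of_all _ fun ω => ?_)
    simp only [Real.norm_of_nonneg (ht0 ω)]
  calc _ ≤ ∫ ω, |C| * t ω ^ 3 ∂μ := by
        refine integral_mono_of_nonneg (ae_of_all _ fun ω => abs_nonneg _) (ht3.const_mul _)
          (ae_of_all _ fun ω => ?_)
        refine (hC _ _ (t ω) (transpose_empGram X _ N) (ht0 ω)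
          (fun i j => ht ω (Sum.inl (i, j))) (fun i => ?_)
          (pinv_empGram_quadratic_nonneg X _ N _)
          ((pinv_empGram_quadratic_le X y _ N).trans ?_)).trans ?_
        · have := ht ω (Sum.inr (Sum.inl i))
          simp only [f, Sum.elim_inr, Sum.elim_inl, h0, sub_zero] at this
          exact this
        · have := (abs_le.1 (ht ω (Sum.inr (Sum.inr ())))).2
          simp only [f, Sum.elim_inr] at this
          linarith
        · exact mul_le_mul_of_nonneg_right (le_abs_self C) (pow_nonneg (ht0 ω) 3)
    _ ≤ |C| * (D * (N : ℝ) ^ (-(3 / 2) : ℝ)) := by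
        rw [integral_const_mul]
        exact mul_le_mul_of_nonneg_left (hD N) (abs_nonneg C)
    _ = _ := by ring

end Expectation

end StationarySystem

theorem proposition8
    {U : Type*} [MeasurableSpace U] (p : Measure U) [IsProbabilityMeasure p]
    {K : ℕ} (X : Fin K → U → ℝ) (y : U → ℝ)
    -- finite sixth moments of the readouts and of the target
    (hX : ∀ i, MemLp (X i) 6 p) (hy : MemLp y 6 p)
    -- the target is not the zero vector
    (hy0 : 0 < ∫ v, y v ^ 2 ∂p)
    -- the Gram matrix has full rank, and `Λ` orthonormalizes the readouts
    (hG : IsUnit (StationarySystem.gram p X).det)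
    (Λ : Matrix (Fin K) (Fin K) ℝ) (hΛ : Λᵀ * StationarySystem.gram p X * Λ = 1)
    -- the capacity vanishes
    (hC : StationarySystem.capacity p X y = 0)
    -- independent samples drawn from `p`
    {Ω : Type*} [MeasurableSpace Ω] (μ : Measure Ω) [IsProbabilityMeasure μ]
    (u : ℕ → Ω → U) (hu : ∀ n, Measurable (u n)) (hlaw : ∀ n, μ.map (u n) = p)
    (hindep : iIndepFun u μ) :
    -- the empirical capacity has a finite expectation over datasets of any size
    (∀ N : ℕ, Integrable (fun ω => StationarySystem.empCapacity (∫ v, y v ^ 2 ∂p) X y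
        (fun n => u n ω) N) μ) ∧
    -- its expectation is `Δ / N + O(N ^ (-3/2))`
    (fun N : ℕ => (∫ ω, StationarySystem.empCapacity (∫ v, y v ^ 2 ∂p) X y
        (fun n => u n ω) N ∂μ)
        - StationarySystem.Delta p (StationarySystem.transformed X Λ) y / (N : ℝ))
      =O[atTop] (fun N : ℕ => (N : ℝ) ^ (-(3 / 2) : ℝ)) ∧
    -- bound on `Δ`
    StationarySystem.Delta p (StationarySystem.transformed X Λ) y
      ≤ Real.sqrt ((∫ v, (∑ i, StationarySystem.transformed X Λ i v ^ 2) ^ 2 ∂p)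
          * ∫ v, y v ^ 4 ∂p) / ∫ v, y v ^ 2 ∂p := by
  have hmp : ∀ n, MeasurePreserving (u n) μ p := fun n => ⟨hu n, hlaw n⟩
  have h0 := StationarySystem.integral_mul_eq_zero_of_capacity_eq_zero
    (fun i => (hX i).mono_exponent (by norm_num)) (hy.mono_exponent (by norm_num)) hy0 hC
  have hint := StationarySystem.integrable_pinv_quadratic hX hy hmp
  refine ⟨fun N => (hint N).div_const _, ?_,
    StationarySystem.Delta_le (StationarySystem.memLp_transformed hX Λ) hy hy0⟩
  obtain ⟨C, hC'⟩ := StationarySystem.exists_integral_abs_sub_le hX hy hG h0 hmp hindep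
  refine IsBigO.of_bound (C / ∫ v, y v ^ 2 ∂p) ?_
  filter_upwards [eventually_ne_atTop 0] with N hN
  obtain ⟨hinv, hval⟩ := StationarySystem.integral_inv_quadratic hX hy h0 hΛ hmp hindep N
  simp only [StationarySystem.empCapacity, StationarySystem.Delta]
  -- Writing `Δ / N` as the exact expectation of the `G⁻¹` form makes the whole error the integral
  -- of one difference.
  rw [integral_div, div_right_comm, ← hval, ← sub_div, ← integral_sub (hint N) hinv, norm_div,
    Real.norm_of_nonneg hy0.le, Real.norm_of_nonneg (Real.rpow_nonneg N.cast_nonneg _),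
    div_mul_eq_mul_div]
  exact div_le_div_of_nonneg_right (abs_integral_le_integral_abs.trans (hC' N hN)) hy0.le
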